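/- Let $d\geq 1$ be an odd integer and let $\|\cdot\|$ be the Euclidean norm on $\mathbb{R}^d$. For $s>0$ and $z\in\mathbb{R}^d$ let $\mathbb{B}^d_s(z)=\{x\in\mathbb{R}^d:\|x-z\|\leq s\}$ and $\mathbb{B}^d_s=\mathbb{B}^d_s(0)$, and let $\delta_x$ be the point measure at $x$. For $r>0$ put $$K_{d,r}(x,y)=\frac{1}{\mathrm{vol}(\mathbb{B}^d_{r/2})}\int_{\mathbb{R}^d}\delta_x(\mathbb{B}^d_{r/2}(z))\,\delta_y(\mathbb{B}^d_{r/2}(z))\,\mathrm{d}z,\qquad x,y\in\mathbb{R}^d.$$ Let $G_d:[0,\infty)\to\mathbb{R}$ be given by $$G_d(r)=\sum_{n=0}^\infty\frac{(-\frac{d+1}{4})_n(-\frac{d-1}{4})_n}{(-\frac d2)_n}\frac{r^{2n}}{n!}={}_2F_1\Big(-\tfrac{d+1}{4},-\tfrac{d-1}{4};-\tfrac d2;r^2\Big)\quad(0\leq r\leq 1),\qquad G_d(r)=0\quad(r>1),$$ where $(f)_n=f(f+1)\cdots(f+n-1)$ and $(f)_0=1$; as $d$ is odd, the series terminates. Then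 $G_d$ is of bounded variation, and for all $x,y\in\mathbb{R}^d$ the function $r\mapsto K_{d,r}(x,y)$ is integrable on $(0,\infty)$ with respect to the Lebesgue--Stieltjes measure $\mathrm{d}G_d$ (which has the atom $-G_d(1)$ at $r=1$), and the kernel $$K_d(x,y):=-\int_0^\infty K_{d,r}(x,y)\,\mathrm{d}G_d(r)$$ satisfies $$K_d(x,y)=(1-\|x-y\|)_+^{\frac{d+1}{2}},\qquad x,y\in\mathbb{R}^d,$$ where $t_+=\max(t,0)$. -/

import Mathlib

open MeasureTheory Set

noncomputable section

namespace AskeyKernel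

/-- The kernel `K_{d,r}(x, y) = vol(B_{r/2})⁻¹ ∫ δ_x(B_{r/2}(z)) δ_y(B_{r/2}(z)) dz`
of the discrepancy of closed Euclidean balls of radius `r / 2` in `ℝ^d`. -/
def ballKernel (d : ℕ) (r : ℝ) (x y : EuclideanSpace ℝ (Fin d)) : ℝ :=
  (volume.real (Metric.closedBall (0 : EuclideanSpace ℝ (Fin d)) (r / 2)))⁻¹ *
    ∫ z : EuclideanSpace ℝ (Fin d),
      (Measure.dirac x).real (Metric.closedBall z (r / 2)) *
        (Measure.dirac y).real (Metric.closedBall z (r / 2))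

/-- The function `G_d(r) = ₂F₁(-(d+1)/4, -(d-1)/4; -d/2; r²)` for `0 ≤ r ≤ 1` and `G_d(r) = 0` for
`r > 1`. It is extended to `r < 0` by the constant `G_d(0)`, so that `dG_d` does not charge
`(-∞, 0]`. -/
def G (d : ℕ) (r : ℝ) : ℝ :=
  if r ≤ 1 then
    ₂F₁ (-((d : ℝ) + 1) / 4) (-((d : ℝ) - 1) / 4) (-(d : ℝ) / 2) ((max r 0) ^ 2)
  else 0

open Classical in
/-- The Lebesgue--Stieltjes signed measure `dF` of a function `F` of bounded variation on `ℝ`, with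
`dF((a, b]) = F(b+) - F(a+)`; the zero measure if `F` is not of bounded variation. -/
def stieltjesMeasure (F : ℝ → ℝ) : SignedMeasure ℝ :=
  if h : BoundedVariationOn F univ then h.vectorMeasure else 0

/-- The kernel `K_d(x, y) = - ∫_0^∞ K_{d,r}(x, y) dG_d(r)`. The weight `G_d` goes down from
`G_d(0) = 1` to `0`, so `-dG_d` is the measure of total mass one that has `G_d` as its tail. -/
def kernel (d : ℕ) (x y : EuclideanSpace ℝ (Fin d)) : ℝ :=
  -∫ᵛ r in Ioi (0 : ℝ), ballKernel d r x y ∂•(stieltjesMeasure (G d))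

end AskeyKernel

end

/-! Write d = 2m + 1, t = ‖x - y‖ and A = ∫₀¹ (1 - s²)^m ds. The kernel for radius r / 2 is a
normalized lens volume. Slicing the lens orthogonally to its axis gives A⁻¹ ∫_{t/r}^1 (1 - s²)^m ds
for r > 0, r ≥ t, and 0 otherwise (`volume_real_lens`, `ballKernel_eq_lensRatio`). The measure dG is
G'(r) dr on (0, 1] plus the atom -G(1) at 1 (`stieltjesMeasure_G`). For 0 < t ≤ 1, integration by
parts moves the derivative onto the lens volume: the boundary term at r = 1 cancels the atom, and
the one at r = t vanishes with the lens. What remains is A⁻¹ T(t) with T(t) = t ∫_t^1 G(r) (1 -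
t²/r²)^m r⁻² dr, so the claim becomes T(t) = A (1 - t)^(m+1).

T is a polynomial of degree at most 2m + 1, and two properties pin it down. Its integrand is O((1 -
t)^m) on an interval of length 1 - t, so T vanishes to order m + 1 at 1. Its even part is ∑ c_n M_n
t^(2n), where c_n are the coefficients of G and M_n = `moment m n`; the hypergeometric recurrence is
exactly what makes c_n M_n = A (m+1 choose 2n) (`weightCoeff_mul_moment`), so T and A (1 - t)^(m+1)
have the same even part. Their difference is odd and vanishes to order m + 1 at 1, hence also at -1;
its degree is below 2m + 2, so it is zero (`weightTransform_eq`). -/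

open MeasureTheory Set

noncomputable section

namespace AskeyKernel

/-! ### Odd polynomials with a high-order zero at 1 -/

open Polynomial in
/-- A real polynomial of size `O((1 - t) ^ N)` at `1` from the left is divisible by
`(X - 1) ^ N`. -/
theorem X_sub_one_pow_dvd_of_abs_eval_le {K : ℝ} (N : ℕ) (P : ℝ[X])
    (h : ∀ t ∈ Ico (1 / 2 : ℝ) 1, |P.eval t| ≤ K * (1 - t) ^ N) :
    (X - C (1 : ℝ)) ^ N ∣ P := by
  induction N generalizing P with
  | zero => simp
  | succ N ih =>
    have h0 : P.eval 1 = 0 := by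
      have h1 : Filter.Tendsto (fun t => |P.eval t|) (nhdsWithin 1 (Iio 1))
          (nhds |P.eval 1|) :=
        ((P.continuous.abs).tendsto 1).mono_left nhdsWithin_le_nhds
      have h2 : Filter.Tendsto (fun t : ℝ => K * (1 - t) ^ (N + 1)) (nhdsWithin 1 (Iio 1))
          (nhds (K * (1 - 1) ^ (N + 1))) :=
        ((by fun_prop : Continuous fun t : ℝ => K * (1 - t) ^ (N + 1)).tendsto 1).mono_left
          nhdsWithin_le_nhds
      have h3 : |P.eval 1| ≤ K * (1 - 1) ^ (N + 1) := by
        refine le_of_tendsto_of_tendsto h1 h2 ?_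
        filter_upwards [Ico_mem_nhdsLT (by norm_num : (1 / 2 : ℝ) < 1)] with t ht using h t ht
      simpa using h3
    obtain ⟨Q, rfl⟩ := dvd_iff_isRoot.2 h0
    rw [pow_succ']
    refine mul_dvd_mul_left _ (ih Q fun t ht => ?_)
    have := h t ht
    rw [eval_mul, abs_mul] at this
    simp only [eval_sub, eval_X, eval_C] at this
    have ht1 : 0 < 1 - t := by linarith [ht.2]
    rw [abs_sub_comm, abs_of_pos ht1, pow_succ] at this
    nlinarith [this]

open Polynomial in
/-- An odd polynomial of degree less than `2 N` that vanishes to order `N` at `1` is zero. -/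
theorem eq_zero_of_odd_of_dvd {N : ℕ} {P : ℝ[X]} (hodd : ∀ t, P.eval (-t) = -P.eval t)
    (hdeg : P.natDegree < 2 * N) (hdvd : (X - C (1 : ℝ)) ^ N ∣ P) : P = 0 := by
  have h2 : (X - C (-1 : ℝ)) ^ N ∣ P := by
    obtain ⟨Q, hQ⟩ := hdvd
    -- P(t) = -P(-t) = -(-t - 1)^N Q(-t), and (-t - 1)^N = (-1)^N (t + 1)^N.
    refine ⟨-((-1) ^ N * Q.comp (-X)), ?_⟩
    refine Polynomial.funext fun t => ?_
    have h3 := congrArg (eval (-t)) hQ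
    rw [hodd] at h3
    simp only [eval_mul, eval_pow, eval_sub, eval_X, eval_C, eval_neg, eval_comp, eval_one] at h3 ⊢
    have h4 : (-t - 1) ^ N = (-1) ^ N * (t - -1) ^ N := by rw [← mul_pow]; ring
    rw [h4] at h3
    linear_combination -h3
  have hcop : IsCoprime ((X - C (1 : ℝ)) ^ N) ((X - C (-1 : ℝ)) ^ N) :=
    (isCoprime_X_sub_C_of_isUnit_sub (by norm_num)).pow
  by_contra hne
  have := natDegree_le_of_dvd (hcop.mul_dvd hdvd h2) hne
  rw [(((monic_X_sub_C (1 : ℝ)).pow N)).natDegree_mul ((monic_X_sub_C (-1 : ℝ)).pow N)] at this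
  simp only [natDegree_pow, natDegree_X_sub_C, mul_one] at this
  omega

/-! ### Moments and hypergeometric coefficients -/

/-- Partial fractions of `m! / (x (x + 1) ⋯ (x + m))`. -/
theorem sum_choose_div (m : ℕ) (x : ℝ) (hx : ∀ k : ℕ, x + k ≠ 0) :
    ∑ k ∈ Finset.range (m + 1), (-1 : ℝ) ^ k * m.choose k / (x + k) =
      m.factorial / (ascPochhammer ℝ (m + 1)).eval x := by
  induction m generalizing x with
  | zero => simp
  | succ m ih =>
    have hx1 : ∀ k : ℕ, x + 1 + k ≠ 0 := fun k => by
      have := hx (k + 1); push_cast at this; convert this using 1; ring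
    -- Pascal's rule: the sum for m + 1 is the difference of the sums for m at x and at x + 1.
    have hsplit : ∑ k ∈ Finset.range (m + 1 + 1), (-1 : ℝ) ^ k * (m + 1).choose k / (x + k) =
        ∑ k ∈ Finset.range (m + 1), (-1 : ℝ) ^ k * m.choose k / (x + k) -
        ∑ k ∈ Finset.range (m + 1), (-1 : ℝ) ^ k * m.choose k / (x + 1 + k) := by
      have h1 : ∑ k ∈ Finset.range (m + 1), (-1 : ℝ) ^ k * m.choose k / (x + k) =
          ∑ k ∈ Finset.range (m + 1), (-1 : ℝ) ^ (k + 1) * m.choose (k + 1) / (x + (k + 1 : ℕ)) +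
            1 / x := by
        rw [← add_zero (∑ k ∈ Finset.range (m + 1), (-1 : ℝ) ^ k * m.choose k / (x + k))]
        have : (0 : ℝ) = (-1 : ℝ) ^ (m + 1) * m.choose (m + 1) / (x + (m + 1 : ℕ)) := by simp
        rw [this, ← Finset.sum_range_succ (fun k : ℕ => (-1 : ℝ) ^ k * m.choose k / (x + k)),
          Finset.sum_range_succ']
        simp
      rw [h1, Finset.sum_range_succ', add_sub_right_comm, ← Finset.sum_sub_distrib]
      congr 1
      · refine Finset.sum_congr rfl fun k _ => ?_
        rw [Nat.choose_succ_succ]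
        push_cast
        rw [show x + ((k : ℝ) + 1) = x + 1 + k by ring]
        ring
      · simp
    have hne : ∀ n : ℕ, ∀ y : ℝ, (∀ k : ℕ, y + k ≠ 0) → (ascPochhammer ℝ n).eval y ≠ 0 := by
      intro n y hy h0
      obtain ⟨k, -, hk⟩ := (ascPochhammer_eval_eq_zero_iff n y).1 h0
      exact hy k (by rw [hk]; ring)
    have e1 : (ascPochhammer ℝ (m + 1 + 1)).eval x =
        (ascPochhammer ℝ (m + 1)).eval x * (x + (m + 1 : ℕ)) := ascPochhammer_succ_eval _ _
    have e2 : (ascPochhammer ℝ (m + 1 + 1)).eval x =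
        x * (ascPochhammer ℝ (m + 1)).eval (x + 1) := by
      rw [ascPochhammer_succ_left]; simp [Polynomial.eval_comp]
    have n0 := hne (m + 1) x hx
    have n1 := hne (m + 1) (x + 1) hx1
    have n2 := hne (m + 1 + 1) x hx
    rw [hsplit, ih x hx, ih (x + 1) hx1, div_sub_div _ _ n0 n1, div_eq_div_iff
      (mul_ne_zero n0 n1) n2, Nat.factorial_succ]
    have e3 := e1.symm.trans e2
    push_cast at e1 e3 ⊢
    rw [e1]
    generalize (ascPochhammer ℝ (m + 1)).eval x = u at *
    generalize (ascPochhammer ℝ (m + 1)).eval (x + 1) = v at *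
    linear_combination (-(m.factorial : ℝ) * u) * e3

/-- The moment `∫₀¹ s ^ (-2 n) (1 - s²) ^ m ds` in the sense of analytic continuation in `n`. -/
def moment (m n : ℕ) : ℝ :=
  ∑ k ∈ Finset.range (m + 1), (-1 : ℝ) ^ k * m.choose k / (2 * k + 1 - 2 * n)

theorem half_sub_add_ne_zero (n k : ℕ) : (1 / 2 - n + k : ℝ) ≠ 0 := by
  intro h
  have : ((1 + 2 * k : ℤ) : ℝ) = (2 * n : ℤ) := by push_cast; linarith
  have := Int.cast_injective this
  omega

theorem moment_eq (m n : ℕ) :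
    moment m n = m.factorial / (2 * (ascPochhammer ℝ (m + 1)).eval (1 / 2 - n : ℝ)) := by
  have h := sum_choose_div m (1 / 2 - n) (half_sub_add_ne_zero n)
  rw [mul_comm, ← div_div, ← h, moment, Finset.sum_div]
  refine Finset.sum_congr rfl fun k _ => ?_
  rw [div_div]
  congr 1
  ring

theorem moment_zero_pos (m : ℕ) : 0 < moment m 0 := by
  rw [moment_eq]
  have : 0 < (ascPochhammer ℝ (m + 1)).eval (1 / 2 - (0 : ℕ) : ℝ) :=
    ascPochhammer_pos _ _ (by norm_num)
  positivity

/-- Follows from factoring (1/2 - (n+1))_{m+2} in two ways, by its last and by its first factor. -/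
theorem moment_succ (m n : ℕ) :
    moment m (n + 1) * (-(2 * n + 1)) = moment m n * (2 * m + 1 - 2 * n) := by
  have hne : ∀ n : ℕ, (ascPochhammer ℝ (m + 1)).eval (1 / 2 - n : ℝ) ≠ 0 := by
    intro n h0
    obtain ⟨k, -, hk⟩ := (ascPochhammer_eval_eq_zero_iff _ _).1 h0
    exact half_sub_add_ne_zero n k (by rw [hk]; ring)
  have e1 : (ascPochhammer ℝ (m + 1 + 1)).eval (1 / 2 - (n + 1 : ℕ) : ℝ) =
      (ascPochhammer ℝ (m + 1)).eval (1 / 2 - (n + 1 : ℕ) : ℝ) *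
        (1 / 2 - (n + 1 : ℕ) + (m + 1 : ℕ)) := ascPochhammer_succ_eval _ _
  have e2 : (ascPochhammer ℝ (m + 1 + 1)).eval (1 / 2 - (n + 1 : ℕ) : ℝ) =
      (1 / 2 - (n + 1 : ℕ)) * (ascPochhammer ℝ (m + 1)).eval (1 / 2 - n : ℝ) := by
    rw [ascPochhammer_succ_left, Polynomial.eval_mul, Polynomial.eval_comp]
    congr 2
    · simp
    · simp; ring
  have e3 := e1.symm.trans e2
  rw [moment_eq, moment_eq]
  have n0 := hne n
  have n1 := hne (n + 1)
  push_cast at e3 n0 n1 ⊢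
  generalize (ascPochhammer ℝ (m + 1)).eval (1 / 2 - (n + 1) : ℝ) = u at *
  generalize (ascPochhammer ℝ (m + 1)).eval (1 / 2 - n : ℝ) = v at *
  field_simp
  linear_combination -2 * e3

/-- The coefficients of the hypergeometric polynomial `G_{2 m + 1}`. -/
def weightCoeff (m n : ℕ) : ℝ :=
  ordinaryHypergeometricCoefficient (-((m : ℝ) + 1) / 2) (-(m : ℝ) / 2) (-(2 * (m : ℝ) + 1) / 2) n

theorem weightCoeff_zero (m : ℕ) : weightCoeff m 0 = 1 := by
  simp [weightCoeff, ordinaryHypergeometricCoefficient]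

theorem neg_half_add_ne_zero (m n : ℕ) : (-(2 * (m : ℝ) + 1) / 2 + n) ≠ 0 := by
  intro h
  have : ((2 * n : ℤ) : ℝ) = (2 * m + 1 : ℤ) := by push_cast; linarith
  have := Int.cast_injective this
  omega

theorem weightCoeff_succ (m n : ℕ) :
    weightCoeff m (n + 1) * ((n + 1) * (-(2 * (m : ℝ) + 1) / 2 + n)) =
      weightCoeff m n * ((-((m : ℝ) + 1) / 2 + n) * (-(m : ℝ) / 2 + n)) := by
  have h1 := neg_half_add_ne_zero m n
  have h2 : (ascPochhammer ℝ n).eval (-(2 * (m : ℝ) + 1) / 2) ≠ 0 := by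
    intro h0
    obtain ⟨k, -, hk⟩ := (ascPochhammer_eval_eq_zero_iff _ _).1 h0
    exact neg_half_add_ne_zero m k (by rw [hk]; ring)
  have h3 : (n.factorial : ℝ) ≠ 0 := by positivity
  have h4 : (n + 1 : ℝ) ≠ 0 := by positivity
  simp only [weightCoeff, ordinaryHypergeometricCoefficient, ascPochhammer_succ_eval,
    Nat.factorial_succ, mul_inv]
  push_cast
  generalize (ascPochhammer ℝ n).eval (-(2 * (m : ℝ) + 1) / 2) = u at *
  generalize -(2 * (m : ℝ) + 1) / 2 + n = v at *
  field_simp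

/-- One of -m/2 and -(m+1)/2 is a nonpositive integer, according to the parity of m, so its rising
factorial vanishes. -/
theorem weightCoeff_eq_zero {m n : ℕ} (h : m < n) : weightCoeff m n = 0 := by
  rw [weightCoeff, ordinaryHypergeometricCoefficient]
  rcases Nat.even_or_odd' m with ⟨k, rfl | rfl⟩
  · rw [(ascPochhammer_eval_eq_zero_iff n (-((2 * k : ℕ) : ℝ) / 2)).2
      ⟨k, by omega, by push_cast; ring⟩]
    simp
  · rw [(ascPochhammer_eval_eq_zero_iff n (-(((2 * k + 1 : ℕ) : ℝ) + 1) / 2)).2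
      ⟨k + 1, by omega, by push_cast; ring⟩]
    simp

/-- The parameters of G are tuned for this identity: in the product of the two recurrences the
factor 2m + 1 - 2n cancels, leaving the ratio of consecutive even binomial coefficients. -/
theorem weightCoeff_mul_moment (m n : ℕ) :
    weightCoeff m n * moment m n = moment m 0 * (m + 1).choose (2 * n) := by
  induction n with
  | zero => simp [weightCoeff_zero]
  | succ n ih =>
    have hw := weightCoeff_succ m n
    have hm := moment_succ m n
    have hv := neg_half_add_ne_zero m n
    have c1 : ((m + 1).choose (2 * n + 1) : ℝ) * (2 * n + 1) =
        (m + 1).choose (2 * n) * (m + 1 - 2 * n) := by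
      rcases le_or_gt (2 * n) (m + 1) with h | h
      · have := Nat.choose_succ_right_eq (m + 1) (2 * n)
        have := congrArg (Nat.cast : ℕ → ℝ) this
        rw [Nat.cast_mul, Nat.cast_mul, Nat.cast_sub h] at this
        push_cast at this; exact this
      · rw [Nat.choose_eq_zero_of_lt h, Nat.choose_eq_zero_of_lt (by omega)]; simp
    have c2 : ((m + 1).choose (2 * (n + 1)) : ℝ) * (2 * n + 2) =
        (m + 1).choose (2 * n + 1) * (m - 2 * n) := by
      rcases le_or_gt (2 * n + 1) (m + 1) with h | h
      · have := Nat.choose_succ_right_eq (m + 1) (2 * n + 1)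
        have := congrArg (Nat.cast : ℕ → ℝ) this
        rw [Nat.cast_mul, Nat.cast_mul, Nat.cast_sub h] at this
        push_cast at this
        rw [show 2 * (n + 1) = 2 * n + 1 + 1 by ring]
        linear_combination this
      · rw [Nat.choose_eq_zero_of_lt h, Nat.choose_eq_zero_of_lt (by omega)]; simp
    have hpos : ((n : ℝ) + 1) * (2 * n + 1) ≠ 0 := by positivity
    refine mul_right_cancel₀ (mul_ne_zero hv hpos) ?_
    calc weightCoeff m (n + 1) * moment m (n + 1) *
          ((-(2 * (m : ℝ) + 1) / 2 + n) * ((n + 1) * (2 * n + 1)))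
        = -(weightCoeff m (n + 1) * ((n + 1) * (-(2 * (m : ℝ) + 1) / 2 + n))) *
            (moment m (n + 1) * (-(2 * n + 1))) := by ring
      _ = -(weightCoeff m n * moment m n) * ((-((m : ℝ) + 1) / 2 + n) * (-(m : ℝ) / 2 + n)) *
            (2 * m + 1 - 2 * n) := by rw [hw, hm]; ring
      _ = _ := by
        rw [ih]
        linear_combination (moment m 0 * (m - 2 * n) * (-(2 * (m : ℝ) + 1) / 2 + n) / 2) * (-c1)
          + (moment m 0 * (2 * n + 1) * (-(2 * (m : ℝ) + 1) / 2 + n) / 2) * (-c2)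

theorem sum_range_two_mul {M : Type*} [AddCommMonoid M] (f : ℕ → M) (n : ℕ) :
    ∑ j ∈ Finset.range (2 * n), f j = ∑ i ∈ Finset.range n, (f (2 * i) + f (2 * i + 1)) := by
  induction n with
  | zero => simp
  | succ n ih =>
    rw [show 2 * (n + 1) = 2 * n + 1 + 1 by ring, Finset.sum_range_succ, Finset.sum_range_succ, ih,
      Finset.sum_range_succ, add_assoc]

theorem one_add_pow_add_one_sub_pow (m : ℕ) (t : ℝ) :
    (1 + t) ^ (m + 1) + (1 - t) ^ (m + 1) =
      2 * ∑ n ∈ Finset.range (m + 1), ((m + 1).choose (2 * n) : ℝ) * t ^ (2 * n) := by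
  -- The range is padded with zero binomials to the even length 2(m + 1), so that terms pair off by
  -- parity.
  have key : ∀ s : ℝ, (1 + s) ^ (m + 1) =
      ∑ j ∈ Finset.range (2 * (m + 1)), ((m + 1).choose j : ℝ) * s ^ j := by
    intro s
    rw [add_comm, add_pow]
    refine Finset.sum_subset_zero_on_sdiff (Finset.range_mono (by omega)) ?_ ?_
    · intro j hj
      simp only [Finset.mem_sdiff, Finset.mem_range] at hj
      rw [Nat.choose_eq_zero_of_lt (by omega)]; simp
    · intro j _; simp [mul_comm]
  rw [sub_eq_add_neg, key t, key (-t), sum_range_two_mul, sum_range_two_mul,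
    ← Finset.sum_add_distrib, Finset.mul_sum]
  refine Finset.sum_congr rfl fun n _ => ?_
  rw [pow_succ (-t), pow_mul (-t), neg_sq, ← pow_mul]
  ring

/-! ### The transform of the weight polynomial -/

/-- The polynomial that `G_{2 m + 1}` agrees with on `[0, 1]`. -/
def weight (m : ℕ) : Polynomial ℝ :=
  ∑ n ∈ Finset.range (m + 1), Polynomial.C (weightCoeff m n) * Polynomial.X ^ (2 * n)

theorem weight_eval (m : ℕ) (r : ℝ) :
    (weight m).eval r = ∑ n ∈ Finset.range (m + 1), weightCoeff m n * r ^ (2 * n) := by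
  simp [weight, Polynomial.eval_finsetSum]

/-- The polynomial `t ∫_t^1 G(r) (1 - t²/r²)^m r⁻² dr`. -/
def weightTransform (m : ℕ) : Polynomial ℝ :=
  ∑ n ∈ Finset.range (m + 1), ∑ k ∈ Finset.range (m + 1),
    Polynomial.C (weightCoeff m n * ((-1 : ℝ) ^ k * m.choose k / (2 * k + 1 - 2 * n))) *
      (Polynomial.X ^ (2 * n) - Polynomial.X ^ (2 * k + 1))

theorem weightTransform_eval (m : ℕ) (t : ℝ) :
    (weightTransform m).eval t = ∑ n ∈ Finset.range (m + 1), ∑ k ∈ Finset.range (m + 1),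
      weightCoeff m n * ((-1 : ℝ) ^ k * m.choose k / (2 * k + 1 - 2 * n)) *
        (t ^ (2 * n) - t ^ (2 * k + 1)) := by
  simp [weightTransform, Polynomial.eval_finsetSum]

theorem integral_weight_eq_eval (m : ℕ) {t : ℝ} (ht : 0 < t) :
    t * ∫ r in t..1, (weight m).eval r * ((1 - t ^ 2 / r ^ 2) ^ m / r ^ 2) =
      (weightTransform m).eval t := by
  have h0 : (0 : ℝ) ∉ uIcc t 1 := by
    rw [mem_uIcc]; rintro (h | h) <;> linarith
  have hpt : ∀ r ∈ uIcc t 1, (weight m).eval r * ((1 - t ^ 2 / r ^ 2) ^ m / r ^ 2) =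
      ∑ n ∈ Finset.range (m + 1), ∑ k ∈ Finset.range (m + 1),
        (weightCoeff m n * ((-1 : ℝ) ^ k * m.choose k) * t ^ (2 * k)) *
          r ^ (2 * n - 2 * k - 2 : ℤ) := by
    intro r hr
    have hr0 : r ≠ 0 := fun h => h0 (h ▸ hr)
    rw [weight_eval, sub_eq_neg_add, add_pow, Finset.sum_div, Finset.sum_mul_sum]
    refine Finset.sum_congr rfl fun n _ => Finset.sum_congr rfl fun k _ => ?_
    have : r ^ (2 * n - 2 * k - 2 : ℤ) = r ^ (2 * n) / (r ^ (2 * k) * r ^ 2) := by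
      rw [zpow_sub₀ hr0, zpow_sub₀ hr0, div_div]
      norm_cast
    rw [this, neg_pow (t ^ 2 / r ^ 2), div_pow, ← pow_mul, ← pow_mul]
    simp only [one_pow]
    field_simp
  -- The powers of r are even, so r⁻¹ never occurs and no logarithm appears.
  have hne : ∀ n k : ℕ, (2 * k + 1 - 2 * n : ℝ) ≠ 0 := by
    intro n k h
    exact half_sub_add_ne_zero n k (by linarith)
  have hint : ∀ n k : ℕ, ∀ c : ℝ, IntervalIntegrable
      (fun r : ℝ => c * r ^ (2 * n - 2 * k - 2 : ℤ)) volume t 1 := fun n k c =>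
    (intervalIntegral.intervalIntegrable_zpow (Or.inr h0)).const_mul c
  have hint' : ∀ n : ℕ, IntervalIntegrable (fun r : ℝ => ∑ k ∈ Finset.range (m + 1),
      (weightCoeff m n * ((-1 : ℝ) ^ k * m.choose k) * t ^ (2 * k)) *
        r ^ (2 * n - 2 * k - 2 : ℤ)) volume t 1 := fun n => by
    have := IntervalIntegrable.sum (Finset.range (m + 1)) (fun k _ => hint n k
      (weightCoeff m n * ((-1 : ℝ) ^ k * m.choose k) * t ^ (2 * k)))
    simpa only [Finset.sum_fn] using this
  rw [intervalIntegral.integral_congr hpt, intervalIntegral.integral_finsetSum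
    (fun n _ => hint' n), weightTransform_eval, Finset.mul_sum]
  refine Finset.sum_congr rfl fun n _ => ?_
  rw [intervalIntegral.integral_finsetSum (fun k _ => hint n k _), Finset.mul_sum]
  refine Finset.sum_congr rfl fun k _ => ?_
  rw [intervalIntegral.integral_const_mul, integral_zpow (Or.inr ⟨by omega, h0⟩)]
  have e : t ^ (2 * n - 2 * k - 2 + 1 : ℤ) = t ^ (2 * n) / t ^ (2 * k + 1) := by
    rw [show (2 * n - 2 * k - 2 + 1 : ℤ) = ((2 * n : ℕ) : ℤ) - ((2 * k + 1 : ℕ) : ℤ) by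
      push_cast; ring, zpow_sub₀ ht.ne', zpow_natCast, zpow_natCast]
  rw [e, one_zpow]
  push_cast
  have h1 := hne n k
  rw [show (2 * n - 2 * k - 2 + 1 : ℝ) = -(2 * k + 1 - 2 * n) by ring]
  field_simp
  ring

theorem exists_abs_weightTransform_eval_le (m : ℕ) :
    ∃ K : ℝ, ∀ t ∈ Ico (1 / 2 : ℝ) 1, |(weightTransform m).eval t| ≤ K * (1 - t) ^ (m + 1) := by
  obtain ⟨M, hM⟩ := (isCompact_Icc (a := (0 : ℝ)) (b := 1)).exists_bound_of_continuousOn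
    (weight m).continuous.continuousOn
  have hM0 : 0 ≤ M := (norm_nonneg _).trans (hM 0 (by simp))
  refine ⟨M * (2 ^ m * 4), fun t ht => ?_⟩
  have ht0 : 0 < t := by linarith [ht.1]
  have ht1 : 0 < 1 - t := by linarith [ht.2]
  rw [← integral_weight_eq_eval m ht0, abs_mul, abs_of_pos ht0]
  -- As r ≤ 1, 1 - t²/r² ≤ 1 - t² ≤ 2(1 - t); the factor 4 bounds r⁻² because r > t ≥ 1/2.
  have hb : ∀ r ∈ uIoc t 1, ‖(weight m).eval r * ((1 - t ^ 2 / r ^ 2) ^ m / r ^ 2)‖ ≤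
      M * ((2 * (1 - t)) ^ m * 4) := by
    intro r hr
    rw [uIoc_of_le ht.2.le] at hr
    have hr0 : 0 < r := ht0.trans hr.1
    have h1 : t ^ 2 / r ^ 2 ≤ 1 := by
      rw [div_le_one (by positivity)]; exact pow_le_pow_left₀ ht0.le hr.1.le 2
    have h2 : t ^ 2 ≤ t ^ 2 / r ^ 2 := by
      rw [le_div_iff₀ (by positivity)]
      have : r ^ 2 ≤ 1 := pow_le_one₀ hr0.le hr.2
      nlinarith [sq_nonneg t]
    have h3 : 1 - t ^ 2 / r ^ 2 ≤ 2 * (1 - t) := by nlinarith [sq_nonneg (1 - t)]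
    have h4 : (1 : ℝ) / r ^ 2 ≤ 4 := by
      rw [div_le_iff₀ (by positivity)]
      nlinarith [ht.1, hr.1]
    rw [norm_mul]
    refine mul_le_mul (hM r ⟨hr0.le, hr.2⟩) ?_ (norm_nonneg _) hM0
    rw [Real.norm_of_nonneg (by have := sub_nonneg.2 h1; positivity), div_eq_mul_one_div]
    refine mul_le_mul (pow_le_pow_left₀ (sub_nonneg.2 h1) h3 m) h4 (by positivity) (by positivity)
  have h5 := intervalIntegral.norm_integral_le_of_norm_le_const hb
  rw [Real.norm_eq_abs, abs_of_pos ht1] at h5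
  calc t * |∫ r in t..1, (weight m).eval r * ((1 - t ^ 2 / r ^ 2) ^ m / r ^ 2)|
      ≤ 1 * |∫ r in t..1, (weight m).eval r * ((1 - t ^ 2 / r ^ 2) ^ m / r ^ 2)| := by
        gcongr; exact ht.2.le
    _ ≤ M * ((2 * (1 - t)) ^ m * 4) * (1 - t) := by rw [one_mul]; exact h5
    _ = M * (2 ^ m * 4) * (1 - t) ^ (m + 1) := by rw [mul_pow]; ring

theorem natDegree_weightTransform_le (m : ℕ) : (weightTransform m).natDegree ≤ 2 * m + 1 := by
  refine Polynomial.natDegree_sum_le_of_forall_le _ _ fun n hn =>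
    Polynomial.natDegree_sum_le_of_forall_le _ _ fun k hk => ?_
  rw [Finset.mem_range] at hn hk
  refine (Polynomial.natDegree_C_mul_le _ _).trans ((Polynomial.natDegree_sub_le _ _).trans ?_)
  simp only [Polynomial.natDegree_X_pow]
  omega

/-- The odd powers t^(2k+1) cancel, and the sum over k multiplying t^(2n) is the moment. -/
theorem weightTransform_eval_add_eval_neg (m : ℕ) (t : ℝ) :
    (weightTransform m).eval t + (weightTransform m).eval (-t) =
      moment m 0 * ((1 + t) ^ (m + 1) + (1 - t) ^ (m + 1)) := by
  rw [one_add_pow_add_one_sub_pow, weightTransform_eval, weightTransform_eval,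
    ← Finset.sum_add_distrib, ← mul_assoc, Finset.mul_sum]
  refine Finset.sum_congr rfl fun n _ => ?_
  have h : moment m 0 * 2 * ((m + 1).choose (2 * n) * t ^ (2 * n)) =
      weightCoeff m n * (2 * t ^ (2 * n)) * moment m n := by
    linear_combination (-2 * t ^ (2 * n)) * weightCoeff_mul_moment m n
  rw [h, moment, Finset.mul_sum, ← Finset.sum_add_distrib]
  refine Finset.sum_congr rfl fun k _ => ?_
  rw [pow_succ (-t), pow_mul (-t), pow_mul (-t), neg_sq, ← pow_mul, ← pow_mul]
  ring

theorem weightTransform_eq (m : ℕ) :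
    weightTransform m = Polynomial.C (moment m 0) * (1 - Polynomial.X) ^ (m + 1) := by
  rw [← sub_eq_zero]
  have hdvd1 : (Polynomial.X - Polynomial.C (1 : ℝ)) ^ (m + 1) ∣ weightTransform m := by
    obtain ⟨K, hK⟩ := exists_abs_weightTransform_eval_le m
    exact X_sub_one_pow_dvd_of_abs_eval_le _ _ hK
  have hdvd2 : (Polynomial.X - Polynomial.C (1 : ℝ)) ^ (m + 1) ∣
      Polynomial.C (moment m 0) * (1 - Polynomial.X) ^ (m + 1) := by
    refine Dvd.dvd.mul_left (pow_dvd_pow_of_dvd ⟨-1, ?_⟩ _) _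
    simp
  refine eq_zero_of_odd_of_dvd (N := m + 1) (fun t => ?_) ?_ (dvd_sub hdvd1 hdvd2)
  · have := weightTransform_eval_add_eval_neg m t
    simp only [Polynomial.eval_sub, Polynomial.eval_mul, Polynomial.eval_C, Polynomial.eval_pow,
      Polynomial.eval_one, Polynomial.eval_X]
    rw [sub_neg_eq_add]
    linear_combination this
  · refine (Polynomial.natDegree_sub_le _ _).trans_lt (max_lt ?_ ?_)
    · have := natDegree_weightTransform_le m; omega
    · refine (Polynomial.natDegree_C_mul_le _ _).trans_lt ?_
      refine (Polynomial.natDegree_pow_le).trans_lt ?_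
      have : (1 - Polynomial.X : Polynomial ℝ).natDegree ≤ 1 :=
        (Polynomial.natDegree_sub_le _ _).trans (by simp)
      nlinarith

/-- The integral of `G(r)` against the derivative in `r` of the normalized lens volume. -/
theorem integral_weight_eq (m : ℕ) {t : ℝ} (ht : 0 < t) :
    t * ∫ r in t..1, (weight m).eval r * ((1 - t ^ 2 / r ^ 2) ^ m / r ^ 2) =
      moment m 0 * (1 - t) ^ (m + 1) := by
  rw [integral_weight_eq_eval m ht, weightTransform_eq]
  simp

/-! ### Bounded variation and the Stieltjes measure of G -/

theorem G_eq (m : ℕ) (r : ℝ) :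
    G (2 * m + 1) r = if r ≤ 1 then (weight m).eval (max r 0) else 0 := by
  rw [G]
  congr 1
  rw [ordinaryHypergeometric_eq_tsum, weight_eval]
  have ha : -(((2 * m + 1 : ℕ) : ℝ) + 1) / 4 = -((m : ℝ) + 1) / 2 := by push_cast; ring
  have hb : -(((2 * m + 1 : ℕ) : ℝ) - 1) / 4 = -(m : ℝ) / 2 := by push_cast; ring
  have hc : -((2 * m + 1 : ℕ) : ℝ) / 2 = -(2 * (m : ℝ) + 1) / 2 := by push_cast; ring
  rw [ha, hb, hc]
  change ∑' n : ℕ, weightCoeff m n • (max r 0 ^ 2) ^ n = _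
  rw [tsum_eq_sum (s := Finset.range (m + 1))]
  · simp only [smul_eq_mul, pow_mul]
  · intro n hn
    rw [weightCoeff_eq_zero (by simpa using hn), zero_smul]

theorem weight_eval_zero (m : ℕ) : (weight m).eval 0 = 1 := by
  rw [weight_eval, Finset.sum_range_succ']
  simp [weightCoeff_zero]

theorem boundedVariationOn_G (m : ℕ) : BoundedVariationOn (G (2 * m + 1)) univ := by
  have hclamp : BoundedVariationOn (fun r : ℝ => min (max r 0) 1) univ := by
    refine MonotoneOn.boundedVariationOn (C := 1)
      (fun x _ y _ h => min_le_min_right _ (max_le_max_right _ h)) fun x _ => ?_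
    rw [abs_of_nonneg (by positivity)]
    exact min_le_right _ _
  have hstep : BoundedVariationOn (fun r : ℝ => if r ≤ 1 then (0 : ℝ) else 1) univ := by
    refine MonotoneOn.boundedVariationOn (C := 1) (fun x _ y _ h => ?_) fun x _ => ?_
    · split_ifs <;> linarith
    · split_ifs <;> simp
  have hstep' : BoundedVariationOn (fun r : ℝ => if r ≤ 1 then (1 : ℝ) else 0) univ := by
    have hL : LipschitzWith 1 (fun x : ℝ => 1 - x) :=
      LipschitzWith.of_dist_le_mul fun x y => by
        rw [Real.dist_eq, Real.dist_eq, NNReal.coe_one, one_mul, sub_sub_sub_cancel_left,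
          abs_sub_comm]
    convert hL.comp_boundedVariationOn hstep using 1
    ext r
    simp only [Function.comp]
    split_ifs <;> simp
  obtain ⟨K, hK⟩ : ∃ K, LipschitzOnWith K (fun r => (weight m).eval r) (Icc 0 1) :=
    ((by simp only [weight_eval]; fun_prop : ContDiff ℝ 1 fun r =>
      (weight m).eval r).contDiffOn).exists_lipschitzOnWith one_ne_zero (convex_Icc 0 1)
      isCompact_Icc
  -- G is the polynomial, Lipschitz on [0, 1], composed with the monotone clamp to [0, 1], times the
  -- indicator of r ≤ 1.
  have hcomp := hK.comp_boundedVariationOn (s := univ) (f := fun r => (weight m).eval r)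
    (fun r _ => ⟨by positivity, min_le_right _ _⟩ :
      MapsTo (fun r : ℝ => min (max r 0) 1) univ (Icc 0 1)) hclamp
  convert hcomp.mul hstep' using 1
  ext r
  rw [G_eq]
  simp only [Function.comp, Pi.mul_apply]
  split_ifs with h
  · rw [mul_one, min_eq_left (max_le h zero_le_one)]
  · simp

/-- The integral against a signed measure with a density. -/
theorem integral_withDensityᵥ {X : Type*} [MeasurableSpace X] {μ : Measure X} {f g : X → ℝ} {K : ℝ}
    (hf : Measurable f) (hK : ∀ x, |f x| ≤ K) (hg : Measurable g) (hgi : Integrable g μ) :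
    (μ.withDensityᵥ g).Integrable f ∧
      ∫ᵛ x, f x ∂•(μ.withDensityᵥ g) = ∫ x, f x * g x ∂μ := by
  -- The density is split into positive and negative parts; bounded functions are integrable against
  -- each resulting finite measure.
  have hfin : ∀ {h : X → ℝ}, Integrable h μ →
      IsFiniteMeasure (μ.withDensity fun x => ENNReal.ofReal (h x)) := fun h =>
    isFiniteMeasure_withDensity_ofReal h.2
  have := hfin hgi
  have := hfin hgi.neg
  have hb : ∀ (ρ : Measure X) [IsFiniteMeasure ρ], Integrable f ρ := fun ρ _ =>
    Integrable.of_bound hf.aestronglyMeasurable K (Filter.Eventually.of_forall hK)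
  have hs : ∀ (ρ : Measure X) [IsFiniteMeasure ρ], ρ.toSignedMeasure.Integrable f := by
    intro ρ _
    rw [VectorMeasure.Integrable, Measure.variation_toSignedMeasure]
    exact hb ρ
  have hflip : (ContinuousLinearMap.lsmul ℝ ℝ : ℝ →L[ℝ] ℝ →L[ℝ] ℝ) =
      (ContinuousLinearMap.lsmul ℝ ℝ : ℝ →L[ℝ] ℝ →L[ℝ] ℝ).flip := by
    ext; simp
  have hpos : ∀ {h : X → ℝ}, Measurable h →
      ∫ x, f x ∂(μ.withDensity fun x => ENNReal.ofReal (h x)) = ∫ x, max (h x) 0 * f x ∂μ := by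
    intro h hh
    rw [integral_withDensity_eq_integral_toReal_smul (by fun_prop)
      (Filter.Eventually.of_forall fun x => ENNReal.ofReal_lt_top)]
    simp [ENNReal.toReal_ofReal']
  have e := withDensityᵥ_eq_withDensity_pos_part_sub_withDensity_neg_part hgi
  refine ⟨?_, ?_⟩
  · rw [e]; exact (hs _).sub_vectorMeasure (hs _)
  · rw [e, VectorMeasure.integral_sub_vectorMeasure (hs _) (hs _), hflip,
      VectorMeasure.integral_toSignedMeasure, VectorMeasure.integral_toSignedMeasure,
      hpos hg, hpos (h := fun x => -g x) hg.neg, ← integral_sub]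
    · congr 1
      ext x
      rcases le_total 0 (g x) with h | h
      · simp [h, mul_comm]
      · simp [h, mul_comm]
    · exact (hgi.pos_part.bdd_mul hf.aestronglyMeasurable (Filter.Eventually.of_forall hK)).congr
        (Filter.Eventually.of_forall fun x => mul_comm _ _)
    · exact (hgi.neg.pos_part.bdd_mul hf.aestronglyMeasurable
        (Filter.Eventually.of_forall hK)).congr (Filter.Eventually.of_forall fun x => mul_comm _ _)

theorem rightLim_G (m : ℕ) (a : ℝ) :
    (G (2 * m + 1)).rightLim a = if a < 1 then (weight m).eval (max a 0) else 0 := by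
  refine rightLim_eq_of_tendsto ?_
  split_ifs with h
  · have hc : Filter.Tendsto (fun r => (weight m).eval (max r 0)) (nhdsWithin a (Ioi a))
        (nhds ((weight m).eval (max a 0))) :=
      ((by fun_prop : Continuous fun r => (weight m).eval (max r 0)).tendsto a).mono_left
        nhdsWithin_le_nhds
    refine hc.congr' ?_
    filter_upwards [Ioo_mem_nhdsGT h] with r hr
    rw [G_eq, if_pos hr.2.le]
  · refine tendsto_const_nhds.congr' ?_
    filter_upwards [self_mem_nhdsWithin] with r hr
    rw [G_eq, if_neg]
    have : a < r := hr
    linarith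

theorem tendsto_G_atTop (m : ℕ) : Filter.Tendsto (G (2 * m + 1)) Filter.atTop (nhds 0) := by
  refine tendsto_const_nhds.congr' ?_
  filter_upwards [Filter.eventually_gt_atTop 1] with r hr
  rw [G_eq, if_neg hr.not_ge]

theorem tendsto_G_atBot (m : ℕ) : Filter.Tendsto (G (2 * m + 1)) Filter.atBot (nhds 1) := by
  refine tendsto_const_nhds.congr' ?_
  filter_upwards [Filter.eventually_le_atBot 0] with r hr
  rw [G_eq, if_pos (hr.trans zero_le_one), max_eq_right hr, weight_eval_zero]

/-- The explicit form of the Stieltjes measure of `G`: a density on `(0, 1]` and an atom at `1`. -/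
def weightMeasure (m : ℕ) : SignedMeasure ℝ :=
  (volume.restrict (Ioc (0 : ℝ) 1)).withDensityᵥ (fun r => (weight m).derivative.eval r) +
    VectorMeasure.dirac 1 (-(weight m).eval 1)

theorem integrable_weight_derivative (m : ℕ) :
    Integrable (fun r => (weight m).derivative.eval r) (volume.restrict (Ioc (0 : ℝ) 1)) :=
  ((weight m).derivative.continuous.integrableOn_Icc).mono_set Ioc_subset_Icc_self

theorem integral_weight_derivative (m : ℕ) (a b : ℝ) :
    ∫ r in a..b, (weight m).derivative.eval r = (weight m).eval b - (weight m).eval a :=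
  intervalIntegral.integral_eq_sub_of_hasDerivAt (fun r _ => (weight m).hasDerivAt r)
    ((weight m).derivative.continuous.intervalIntegrable _ _)

theorem weightMeasure_Ioi (m : ℕ) (a : ℝ) :
    weightMeasure m (Ioi a) = -if a < 1 then (weight m).eval (max a 0) else 0 := by
  rw [weightMeasure, _root_.add_apply, withDensityᵥ_apply (integrable_weight_derivative m)
    measurableSet_Ioi, Measure.restrict_restrict measurableSet_Ioi]
  split_ifs with h
  · rw [VectorMeasure.dirac_apply_of_mem measurableSet_Ioi h,
      show Ioi a ∩ Ioc 0 1 = Ioc (max a 0) 1 by ext; simp; tauto,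
      ← intervalIntegral.integral_of_le (max_le h.le zero_le_one), integral_weight_derivative]
    ring
  · rw [VectorMeasure.dirac_apply_of_notMem (by simpa using h),
      show Ioi a ∩ Ioc 0 1 = ∅ by ext; simp; intros; linarith]
    simp

/-- The rays (a, ∞) form a π-system generating the Borel sets. The whole line is not among them, so
the total masses, both -1, are compared separately. -/
theorem stieltjesMeasure_G (m : ℕ) : stieltjesMeasure (G (2 * m + 1)) = weightMeasure m := by
  rw [stieltjesMeasure, dif_pos (boundedVariationOn_G m)]
  refine VectorMeasure.ext_of_generateFrom (range Ioi) ?_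
    (BorelSpace.measurable_eq.trans (borel_eq_generateFrom_Ioi ℝ)) isPiSystem_Ioi ?_
  · rintro _ ⟨a, rfl⟩
    rw [BoundedVariationOn.vectorMeasure_Ioi, rightLim_G, weightMeasure_Ioi,
      (tendsto_G_atTop m).limUnder_eq, zero_sub]
  · rw [BoundedVariationOn.vectorMeasure_univ, (tendsto_G_atTop m).limUnder_eq,
      (tendsto_G_atBot m).limUnder_eq, weightMeasure, _root_.add_apply,
      withDensityᵥ_apply (integrable_weight_derivative m) MeasurableSet.univ,
      VectorMeasure.dirac_apply_of_mem MeasurableSet.univ (mem_univ _), Measure.restrict_univ,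
      ← intervalIntegral.integral_of_le zero_le_one, integral_weight_derivative, weight_eval_zero]
    ring

theorem weightMeasure_restrict_Ioi (m : ℕ) :
    (weightMeasure m).restrict (Ioi 0) = weightMeasure m := by
  ext s hs
  rw [VectorMeasure.restrict_apply _ measurableSet_Ioi hs, weightMeasure, _root_.add_apply,
    _root_.add_apply, withDensityᵥ_apply (integrable_weight_derivative m) hs,
    withDensityᵥ_apply (integrable_weight_derivative m) (hs.inter measurableSet_Ioi),
    Measure.restrict_restrict hs, Measure.restrict_restrict (hs.inter measurableSet_Ioi)]
  congr 1
  · rw [inter_assoc, inter_eq_right.2 (Ioc_subset_Ioi_self : Ioc (0 : ℝ) 1 ⊆ Ioi 0)]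
  · by_cases h : (1 : ℝ) ∈ s
    · rw [VectorMeasure.dirac_apply_of_mem hs h,
        VectorMeasure.dirac_apply_of_mem (hs.inter measurableSet_Ioi) ⟨h, mem_Ioi.2 one_pos⟩]
    · rw [VectorMeasure.dirac_apply_of_notMem h,
        VectorMeasure.dirac_apply_of_notMem fun h' => h h'.1]

theorem integral_stieltjesMeasure_G (m : ℕ) {f : ℝ → ℝ} {K : ℝ} (hf : Measurable f)
    (hK : ∀ x, |f x| ≤ K) :
    (stieltjesMeasure (G (2 * m + 1))).IntegrableOn f (Ioi 0) ∧
      ∫ᵛ r in Ioi (0 : ℝ), f r ∂•(stieltjesMeasure (G (2 * m + 1))) =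
        (∫ r in (0 : ℝ)..1, f r * (weight m).derivative.eval r) - f 1 * (weight m).eval 1 := by
  obtain ⟨h1, h2⟩ := integral_withDensityᵥ hf hK
    (weight m).derivative.continuous.measurable (integrable_weight_derivative m)
  have h3 : (VectorMeasure.dirac (1 : ℝ) (-(weight m).eval 1)).Integrable f := by
    rw [VectorMeasure.Integrable, VectorMeasure.variation_dirac]
    exact Integrable.smul_measure (integrable_dirac (by simp)) (by simp)
  rw [VectorMeasure.IntegrableOn, stieltjesMeasure_G, weightMeasure_restrict_Ioi, weightMeasure]
  refine ⟨h1.add_vectorMeasure h3, ?_⟩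
  rw [VectorMeasure.integral_add_vectorMeasure h1 h3, h2, VectorMeasure.integral_dirac,
    intervalIntegral.integral_of_le zero_le_one]
  simp [sub_eq_add_neg]

/-! ### Volume of a lens -/

section Lens

open scoped RealInnerProductSpace

variable {E : Type*} [NormedAddCommGroup E] [InnerProductSpace ℝ E]

theorem norm_smul_add_sq {v : E} (hv : ‖v‖ = 1) (s : ℝ) (w : (Submodule.span ℝ {v})ᗮ) :
    ‖s • v + (w : E)‖ ^ 2 = s ^ 2 + ‖w‖ ^ 2 := by
  have h : ⟪s • v, (w : E)⟫ = 0 := by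
    rw [real_inner_smul_left, Submodule.mem_orthogonal_singleton_iff_inner_right.1 w.2, mul_zero]
  have := norm_add_sq_eq_norm_sq_add_norm_sq_of_inner_eq_zero _ _ h
  rw [← sq, ← sq, ← sq, norm_smul, hv, mul_one, Real.norm_eq_abs, sq_abs] at this
  simpa using this

/-- The slices of a lens orthogonal to its axis are balls. -/
theorem lens_slice {v : E} (hv : ‖v‖ = 1) {a R : ℝ} (ha : 0 ≤ a) (s : ℝ) :
    Prod.mk s ⁻¹' ((fun p : ℝ × (Submodule.span ℝ {v})ᗮ => p.1 • v + (p.2 : E)) ⁻¹'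
      (Metric.closedBall (a • v) R ∩ Metric.closedBall (-(a • v)) R)) =
      if |s| ≤ R - a then Metric.closedBall 0 (√(R ^ 2 - (|s| + a) ^ 2)) else ∅ := by
  have hiff : ∀ w : (Submodule.span ℝ {v})ᗮ, ‖s • v + (w : E) - a • v‖ ≤ R ∧
      ‖s • v + (w : E) - -(a • v)‖ ≤ R ↔ 0 ≤ R ∧ (|s| + a) ^ 2 + ‖w‖ ^ 2 ≤ R ^ 2 := by
    intro w
    rw [show s • v + (w : E) - a • v = (s - a) • v + (w : E) by rw [sub_smul]; abel,
      show s • v + (w : E) - -(a • v) = (s + a) • v + (w : E) by rw [add_smul]; abel]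
    by_cases hR : 0 ≤ R
    · rw [← sq_le_sq₀ (norm_nonneg _) hR, ← sq_le_sq₀ (norm_nonneg _) hR, norm_smul_add_sq hv,
        norm_smul_add_sq hv]
      -- The constraint from the centre on the other side of the hyperplane s = 0 implies the one
      -- from the nearer centre.
      rcases abs_cases s with ⟨h, h'⟩ | ⟨h, h'⟩ <;> rw [h]
      · exact ⟨fun hh => ⟨hR, hh.2⟩, fun hh => ⟨by nlinarith [hh.2], hh.2⟩⟩
      · exact ⟨fun hh => ⟨hR, by nlinarith [hh.1]⟩,
          fun hh => ⟨by nlinarith [hh.2], by nlinarith [hh.2]⟩⟩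
    · exact ⟨fun hh => absurd ((norm_nonneg _).trans hh.1) hR, fun hh => absurd hh.1 hR⟩
  ext w
  simp only [mem_preimage, mem_inter_iff, mem_closedBall_iff_norm]
  rw [hiff w]
  have hs0 := abs_nonneg s
  split_ifs with h
  · have hR : 0 ≤ R := by linarith
    have h1 : 0 ≤ R ^ 2 - (|s| + a) ^ 2 := by nlinarith
    rw [mem_closedBall_zero_iff, Real.le_sqrt (norm_nonneg _) h1]
    constructor
    · intro hh; linarith [hh.2]
    · intro hh; exact ⟨hR, by linarith⟩
  · simp only [mem_empty_iff_false, iff_false, not_and]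
    intro hR hh
    exact h (by nlinarith [sq_nonneg ‖w‖])

variable [FiniteDimensional ℝ E] [MeasurableSpace E] [BorelSpace E]

/-- Splitting off a line is measure preserving. -/
theorem measurePreserving_smul_add {v : E} (hv : ‖v‖ = 1) :
    MeasurePreserving (fun p : ℝ × (Submodule.span ℝ {v})ᗮ => p.1 • v + (p.2 : E)) := by
  have h1 := (LinearIsometryEquiv.toSpanUnitSingleton (𝕜 := ℝ) v hv).measurePreserving
  have h2 := h1.prod (MeasurePreserving.id (volume : Measure (Submodule.span ℝ {v})ᗮ))
  have h3 := (WithLp.volume_preserving_toLp (Submodule.span ℝ {v}) (Submodule.span ℝ {v})ᗮ).comp h2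
  exact (Submodule.span ℝ {v}).orthogonalDecomposition.symm.measurePreserving.comp h3

/-- The volume of the intersection of two balls of equal radius in odd dimension. -/
theorem volume_real_lens {m : ℕ} (hE : Module.finrank ℝ E = 2 * m + 1) {v : E} (hv : ‖v‖ = 1)
    {a R : ℝ} (ha : 0 ≤ a) (hR : 0 < R) (haR : a ≤ R) :
    volume.real (Metric.closedBall (a • v) R ∩ Metric.closedBall (-(a • v)) R) =
      volume.real (Metric.ball (0 : (Submodule.span ℝ {v})ᗮ) 1) * (2 * R ^ (2 * m + 1)) *
        ∫ s in (a / R)..1, (1 - s ^ 2) ^ m := by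
  have hfr : Module.finrank ℝ (Submodule.span ℝ {v})ᗮ = 2 * m := by
    have : Fact (Module.finrank ℝ E = 2 * m + 1) := ⟨hE⟩
    exact Submodule.finrank_orthogonal_span_singleton (by rintro rfl; simp at hv)
  have hmeas : MeasurableSet (Metric.closedBall (a • v) R ∩ Metric.closedBall (-(a • v)) R) :=
    measurableSet_closedBall.inter measurableSet_closedBall
  have hpre := measurePreserving_smul_add hv
  have hmeas' := hpre.measurable hmeas
  rw [measureReal_def, ← hpre.measure_preimage hmeas.nullMeasurableSet, Measure.volume_eq_prod,
    Measure.prod_apply hmeas',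
    ← integral_toReal (measurable_measure_prodMk_left hmeas').aemeasurable]
  swap
  · refine Filter.Eventually.of_forall fun s => ?_
    rw [lens_slice hv ha]
    split_ifs
    · exact measure_closedBall_lt_top
    · simp
  set ω := volume.real (Metric.ball (0 : (Submodule.span ℝ {v})ᗮ) 1) with hω
  let g : ℝ → ℝ := (Iic (R - a)).indicator fun s => (R ^ 2 - (s + a) ^ 2) ^ m * ω
  have hslice : ∀ s : ℝ, (volume (Prod.mk s ⁻¹'
      ((fun p : ℝ × (Submodule.span ℝ {v})ᗮ => p.1 • v + (p.2 : E)) ⁻¹'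
      (Metric.closedBall (a • v) R ∩ Metric.closedBall (-(a • v)) R)))).toReal = g |s| := by
    intro s
    rw [lens_slice hv ha]
    have hs0 := abs_nonneg s
    split_ifs with h
    · rw [← measureReal_def, Measure.addHaar_real_closedBall _ _ (Real.sqrt_nonneg _), hfr, pow_mul,
        Real.sq_sqrt (by nlinarith)]
      simp [g, h, hω]
    · simp [g, h]
  simp_rw [hslice]
  -- The factor 2 comes from the symmetry s ↦ -s; the shift by a and the scaling by R then bring the
  -- interval to (a/R, 1).
  rw [integral_comp_abs, setIntegral_indicator measurableSet_Iic, Ioi_inter_Iic,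
    ← intervalIntegral.integral_of_le (by linarith), intervalIntegral.integral_mul_const,
    intervalIntegral.integral_comp_add_right (fun s => (R ^ 2 - s ^ 2) ^ m) a]
  have hscale := intervalIntegral.mul_integral_comp_mul_right (a := a / R) (b := 1)
    (f := fun s => (R ^ 2 - s ^ 2) ^ m) R
  rw [div_mul_cancel₀ _ hR.ne', one_mul] at hscale
  rw [zero_add, sub_add_cancel, ← hscale]
  have : ∀ s : ℝ, (R ^ 2 - (s * R) ^ 2) ^ m = R ^ (2 * m) * (1 - s ^ 2) ^ m := by
    intro s
    rw [pow_mul, ← mul_pow]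
    ring
  simp_rw [this]
  rw [intervalIntegral.integral_const_mul]
  ring

end Lens

/-! ### The ball kernel as a lens ratio -/

/-- The tail `∫_u^1 (1 - s²)^m ds`. -/
def tailIntegral (m : ℕ) (u : ℝ) : ℝ := ∫ s in u..1, (1 - s ^ 2) ^ m

theorem hasDerivAt_tailIntegral (m : ℕ) (u : ℝ) :
    HasDerivAt (tailIntegral m) (-(1 - u ^ 2) ^ m) u := by
  have hc : Continuous fun s : ℝ => (1 - s ^ 2) ^ m := by fun_prop
  exact intervalIntegral.integral_hasDerivAt_left (hc.intervalIntegrable _ _)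
    (hc.stronglyMeasurableAtFilter _ _) hc.continuousAt

theorem continuous_tailIntegral (m : ℕ) : Continuous (tailIntegral m) :=
  continuous_iff_continuousAt.2 fun u => (hasDerivAt_tailIntegral m u).continuousAt

theorem tailIntegral_one (m : ℕ) : tailIntegral m 1 = 0 := by simp [tailIntegral]

theorem tailIntegral_zero (m : ℕ) : tailIntegral m 0 = moment m 0 := by
  have hpt : ∀ s : ℝ, (1 - s ^ 2) ^ m =
      ∑ k ∈ Finset.range (m + 1), ((-1 : ℝ) ^ k * m.choose k) * s ^ (2 * k) := by
    intro s
    rw [sub_eq_neg_add, add_pow]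
    refine Finset.sum_congr rfl fun k _ => ?_
    rw [neg_pow, ← pow_mul]
    simp only [one_pow]
    ring
  rw [tailIntegral, moment]
  simp_rw [hpt]
  rw [intervalIntegral.integral_finsetSum
    (fun k _ => (by fun_prop : Continuous _).intervalIntegrable _ _)]
  refine Finset.sum_congr rfl fun k _ => ?_
  rw [intervalIntegral.integral_const_mul, integral_pow]
  simp
  ring

theorem abs_tailIntegral_le (m : ℕ) {u : ℝ} (h0 : 0 ≤ u) (h1 : u ≤ 1) : |tailIntegral m u| ≤ 1 := by
  have hb : ∀ s ∈ uIoc u 1, ‖(1 - s ^ 2) ^ m‖ ≤ 1 := by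
    intro s hs
    rw [uIoc_of_le h1] at hs
    have hs0 : 0 ≤ s := h0.trans hs.1.le
    have : s ^ 2 ≤ 1 := pow_le_one₀ hs0 hs.2
    rw [norm_pow]
    refine pow_le_one₀ (norm_nonneg _) ?_
    rw [Real.norm_of_nonneg (by linarith)]
    nlinarith [sq_nonneg s]
  have := intervalIntegral.norm_integral_le_of_norm_le_const hb
  rw [one_mul, abs_of_nonneg (sub_nonneg.2 h1)] at this
  exact this.trans (by linarith)

/-- The normalized lens volume as a function of the diameter `r` of the balls and the distance `t`
of their centers. -/
def lensRatio (m : ℕ) (t r : ℝ) : ℝ :=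
  if 0 < r ∧ t ≤ r then tailIntegral m (t / r) / moment m 0 else 0

theorem measurable_lensRatio (m : ℕ) (t : ℝ) : Measurable (lensRatio m t) := by
  refine Measurable.ite (measurableSet_Ioi.inter measurableSet_Ici) ?_ measurable_const
  exact ((continuous_tailIntegral m).measurable.comp
    (measurable_const.div measurable_id)).div_const _

theorem abs_lensRatio_le (m : ℕ) {t : ℝ} (ht : 0 ≤ t) (r : ℝ) :
    |lensRatio m t r| ≤ 1 / moment m 0 := by
  have h0 := moment_zero_pos m
  rw [lensRatio]
  split_ifs with h
  · rw [abs_div, abs_of_pos h0]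
    gcongr
    exact abs_tailIntegral_le m (div_nonneg ht h.1.le) ((div_le_one h.1).2 h.2)
  · rw [abs_zero]; positivity

theorem ballKernel_eq_measureReal (d : ℕ) (r : ℝ) (x y : EuclideanSpace ℝ (Fin d)) :
    ballKernel d r x y =
      (volume.real (Metric.closedBall (0 : EuclideanSpace ℝ (Fin d)) (r / 2)))⁻¹ *
        volume.real (Metric.closedBall x (r / 2) ∩ Metric.closedBall y (r / 2)) := by
  rw [ballKernel]
  congr 1
  rw [← integral_indicator_one (measurableSet_closedBall.inter measurableSet_closedBall)]
  congr 1
  ext z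
  have hd : ∀ w : EuclideanSpace ℝ (Fin d), (Measure.dirac w).real (Metric.closedBall z (r / 2)) =
      (Metric.closedBall w (r / 2)).indicator 1 z := by
    intro w
    rw [measureReal_def, Measure.dirac_apply' _ measurableSet_closedBall]
    by_cases h : dist z w ≤ r / 2
    · rw [indicator_of_mem (by rwa [Metric.mem_closedBall, dist_comm]),
        indicator_of_mem (by rwa [Metric.mem_closedBall])]
      simp
    · rw [indicator_of_notMem (by rwa [Metric.mem_closedBall, dist_comm]),
        indicator_of_notMem (by rwa [Metric.mem_closedBall])]
      simp
  rw [hd, hd, inter_indicator_one]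
  rfl

theorem ballKernel_eq_lensRatio (m : ℕ) (r : ℝ) (x y : EuclideanSpace ℝ (Fin (2 * m + 1))) :
    ballKernel (2 * m + 1) r x y = lensRatio m ‖x - y‖ r := by
  rw [ballKernel_eq_measureReal, lensRatio]
  split_ifs with h
  · obtain ⟨hr, hxy⟩ := h
    have hfin : Module.finrank ℝ (EuclideanSpace ℝ (Fin (2 * m + 1))) = 2 * m + 1 := by simp
    obtain ⟨v, hv, hxv⟩ : ∃ v : EuclideanSpace ℝ (Fin (2 * m + 1)),
        ‖v‖ = 1 ∧ x - y = ‖x - y‖ • v := by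
      -- For x = y any unit vector serves as axis.
      by_cases h0 : x - y = 0
      · obtain ⟨v, hv⟩ := exists_norm_eq (EuclideanSpace ℝ (Fin (2 * m + 1))) zero_le_one
        exact ⟨v, hv, by simp [h0]⟩
      · have hn : ‖x - y‖ ≠ 0 := norm_ne_zero_iff.2 h0
        exact ⟨‖x - y‖⁻¹ • (x - y), by rw [norm_smul, norm_inv, norm_norm, inv_mul_cancel₀ hn],
          by rw [smul_smul, mul_inv_cancel₀ hn, one_smul]⟩
    have ht := norm_nonneg (x - y)
    have h1 := volume_real_lens hfin hv (a := ‖x - y‖ / 2) (R := r / 2) (by positivity)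
      (by positivity) (by linarith)
    have h2 := volume_real_lens hfin hv (a := 0) (R := r / 2) le_rfl (by positivity)
      (by positivity)
    rw [zero_smul, neg_zero, inter_self, zero_div] at h2
    rw [div_div_div_cancel_right₀ (two_ne_zero)] at h1
    -- Translating the midpoint of x and y to the origin puts the lens in symmetric position.
    have htrans : volume.real (Metric.closedBall x (r / 2) ∩ Metric.closedBall y (r / 2)) =
        volume.real (Metric.closedBall ((‖x - y‖ / 2) • v) (r / 2) ∩
          Metric.closedBall (-((‖x - y‖ / 2) • v)) (r / 2)) := by
      have hhalf : (‖x - y‖ / 2) • v = (2⁻¹ : ℝ) • (x - y) := by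
        conv_rhs => rw [hxv]
        rw [smul_smul]; congr 1; ring
      have hx : (‖x - y‖ / 2) • v + (2⁻¹ : ℝ) • (x + y) = x := by
        rw [hhalf]; module
      have hy : -((‖x - y‖ / 2) • v) + (2⁻¹ : ℝ) • (x + y) = y := by
        rw [hhalf]; module
      rw [measureReal_def, measureReal_def, ← measure_preimage_add_right volume
        ((2⁻¹ : ℝ) • (x + y)) (Metric.closedBall x (r / 2) ∩ Metric.closedBall y (r / 2))]
      congr 2
      ext z
      simp only [mem_preimage, mem_inter_iff, Metric.mem_closedBall]
      have ex := dist_add_right z ((‖x - y‖ / 2) • v) ((2⁻¹ : ℝ) • (x + y))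
      have ey := dist_add_right z (-((‖x - y‖ / 2) • v)) ((2⁻¹ : ℝ) • (x + y))
      rw [hx] at ex
      rw [hy] at ey
      rw [ex, ey]
    rw [htrans, h1, h2]
    change _ * (_ * tailIntegral m _) = _
    rw [show (∫ s in (0 : ℝ)..1, (1 - s ^ 2) ^ m) = moment m 0 from tailIntegral_zero m]
    have hω : volume.real (Metric.ball (0 : (Submodule.span ℝ {v})ᗮ) 1) ≠ 0 :=
      (ENNReal.toReal_pos (Metric.measure_ball_pos _ _ one_pos).ne' measure_ball_lt_top.ne).ne'
    have hm := (moment_zero_pos m).ne'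
    field_simp
  · rcases le_or_gt r 0 with hr | hr
    -- For r ≤ 0 the ball is empty or a point, hence null, and the inverse of its volume is 0 by
    -- convention.
    · have : volume.real
          (Metric.closedBall (0 : EuclideanSpace ℝ (Fin (2 * m + 1))) (r / 2)) = 0 := by
        rw [measureReal_def, measure_mono_null (Metric.closedBall_subset_closedBall
          (by linarith : r / 2 ≤ 0)) (by simp)]
        simp
      rw [this]; simp
    · have hxy : r < ‖x - y‖ := by
        by_contra hc; exact h ⟨hr, not_lt.1 hc⟩
      have : Disjoint (Metric.closedBall x (r / 2)) (Metric.closedBall y (r / 2)) :=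
        Metric.closedBall_disjoint_closedBall (by rw [dist_eq_norm]; linarith)
      rw [this.inter_eq]; simp

/-! ### Integration by parts against dG -/

theorem lensRatio_zero (m : ℕ) {r : ℝ} (hr : 0 < r) : lensRatio m 0 r = 1 := by
  rw [lensRatio, if_pos ⟨hr, hr.le⟩, zero_div, tailIntegral_zero, div_self (moment_zero_pos m).ne']

theorem integral_lensRatio_eq_of_pos (m : ℕ) {t : ℝ} (ht : 0 < t) (ht1 : t ≤ 1) :
    (∫ r in (0 : ℝ)..1, lensRatio m t r * (weight m).derivative.eval r) =
      (∫ r in t..1, tailIntegral m (t / r) * (weight m).derivative.eval r) / moment m 0 := by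
  rw [← intervalIntegral.integral_div, intervalIntegral.integral_of_le zero_le_one,
    intervalIntegral.integral_of_le ht1, ← integral_Icc_eq_integral_Ioc,
    ← integral_Icc_eq_integral_Ioc]
  have h : ∀ r ∈ Icc (0 : ℝ) 1, r ∉ Icc t 1 →
      lensRatio m t r * (weight m).derivative.eval r = 0 := by
    intro r hr hrt
    rw [lensRatio, if_neg fun h => hrt ⟨h.2, hr.2⟩, zero_mul]
  rw [setIntegral_eq_of_subset_of_forall_sdiff_eq_zero measurableSet_Icc
    (Icc_subset_Icc_left ht.le) fun r hr => h r hr.1 hr.2]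
  refine setIntegral_congr_fun measurableSet_Icc fun r hr => ?_
  rw [lensRatio, if_pos ⟨ht.trans_le hr.1, hr.1⟩]
  ring

theorem hasDerivAt_tailIntegral_div (m : ℕ) (t : ℝ) {r : ℝ} (hr : r ≠ 0) :
    HasDerivAt (fun r => tailIntegral m (t / r)) (t * ((1 - t ^ 2 / r ^ 2) ^ m / r ^ 2)) r := by
  have h1 : HasDerivAt (fun r : ℝ => t / r) (-t / r ^ 2) r := by
    have := (hasDerivAt_const r t).fun_div (hasDerivAt_id' r) hr
    rwa [zero_mul, mul_one, zero_sub] at this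
  have h2 := (hasDerivAt_tailIntegral m (t / r)).comp r h1
  rw [show t * ((1 - t ^ 2 / r ^ 2) ^ m / r ^ 2) = -(1 - (t / r) ^ 2) ^ m * (-t / r ^ 2) by
    rw [div_pow]; ring]
  exact h2

/-- The boundary term at r = t drops out because the tail integral vanishes at 1; the one at r = 1
stays, to be cancelled by the atom of dG. -/
theorem integral_tailIntegral_mul_derivative (m : ℕ) {t : ℝ} (ht : 0 < t) :
    ∫ r in t..1, tailIntegral m (t / r) * (weight m).derivative.eval r =
      tailIntegral m t * (weight m).eval 1 - moment m 0 * (1 - t) ^ (m + 1) := by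
  have h0 : (0 : ℝ) ∉ uIcc t 1 := by
    rw [mem_uIcc]; rintro (h | h) <;> linarith
  have hne : ∀ r ∈ uIcc t 1, r ≠ 0 := fun r hr h => h0 (h ▸ hr)
  rw [intervalIntegral.integral_mul_deriv_eq_deriv_mul
    (fun r hr => hasDerivAt_tailIntegral_div m t (hne r hr))
    (fun r _ => (weight m).hasDerivAt r) ?_
    ((weight m).derivative.continuous.intervalIntegrable _ _), div_one, div_self ht.ne',
    tailIntegral_one, zero_mul, sub_zero, ← integral_weight_eq m ht,
    ← intervalIntegral.integral_const_mul]
  · congr 2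
    ext r
    ring
  · refine ContinuousOn.intervalIntegrable fun r hr => ContinuousAt.continuousWithinAt ?_
    have := hne r hr
    fun_prop (disch := positivity)

/-- The Stieltjes integral of the normalized lens volume against `dG`. -/
theorem integral_lensRatio (m : ℕ) {t : ℝ} (ht : 0 ≤ t) :
    (∫ r in (0 : ℝ)..1, lensRatio m t r * (weight m).derivative.eval r) -
      lensRatio m t 1 * (weight m).eval 1 = -(max (1 - t) 0) ^ (m + 1) := by
  have hA := (moment_zero_pos m).ne'
  rcases ht.eq_or_lt with rfl | ht0
  -- At t = 0 the ratio is 1 for every r > 0, so only the total mass -G(0) = -1 of dG matters.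
  · have h : ∫ r in (0 : ℝ)..1, lensRatio m 0 r * (weight m).derivative.eval r =
        ∫ r in (0 : ℝ)..1, (weight m).derivative.eval r := by
      refine intervalIntegral.integral_congr_ae (Filter.Eventually.of_forall fun r hr => ?_)
      rw [uIoc_of_le zero_le_one] at hr
      rw [lensRatio_zero m hr.1, one_mul]
    rw [h, integral_weight_derivative, lensRatio_zero m one_pos, weight_eval_zero]
    simp
  · rcases le_or_gt t 1 with h1 | h1
    · rw [integral_lensRatio_eq_of_pos m ht0 h1, integral_tailIntegral_mul_derivative m ht0,
        lensRatio, if_pos ⟨one_pos, h1⟩, div_one, max_eq_left (sub_nonneg.2 h1)]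
      field_simp
      ring
    · have h : ∀ r ∈ uIcc (0 : ℝ) 1, lensRatio m t r * (weight m).derivative.eval r = 0 := by
        intro r hr
        rw [uIcc_of_le zero_le_one] at hr
        rw [lensRatio, if_neg fun h => (h.2.trans hr.2).not_gt h1, zero_mul]
      rw [intervalIntegral.integral_congr h, lensRatio, if_neg fun h => h.2.not_gt h1,
        max_eq_right (by linarith)]
      simp

end AskeyKernel

end

theorem mainTheorem6 (d : ℕ) (hd : Odd d) :
    BoundedVariationOn (AskeyKernel.G d) Set.univ ∧
    ∀ x y : EuclideanSpace ℝ (Fin d),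
      (AskeyKernel.stieltjesMeasure (AskeyKernel.G d)).IntegrableOn
        (fun r => AskeyKernel.ballKernel d r x y) (Set.Ioi 0) ∧
      AskeyKernel.kernel d x y = (max (1 - ‖x - y‖) 0) ^ ((d + 1) / 2) := by
  obtain ⟨m, rfl⟩ := hd
  refine ⟨AskeyKernel.boundedVariationOn_G m, fun x y => ?_⟩
  have h := AskeyKernel.integral_stieltjesMeasure_G m (AskeyKernel.measurable_lensRatio m ‖x - y‖)
    (AskeyKernel.abs_lensRatio_le m (norm_nonneg (x - y)))
  rw [AskeyKernel.integral_lensRatio m (norm_nonneg _)] at h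
  rw [AskeyKernel.kernel, show (2 * m + 1 + 1) / 2 = m + 1 by omega]
  simp only [AskeyKernel.ballKernel_eq_lensRatio]
  exact ⟨h.1, by rw [h.2, neg_neg]⟩
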